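/- Let $(W,S)$ be a Coxeter system of finite rank with length function $\ell$, and let $R(W)$ be its set of reflections (the conjugates of elements of $S$). Let $W^+$ be the semidirect product of $W$ by the group of diagram automorphisms, i.e. the permutations of $S$ that preserve the Coxeter matrix (equivalently, that induce automorphisms of $W$). Extend $\ell$ to $W^+$ by $\ell(w\sigma)=\ell(w)$ for $w\in W$ and $\sigma$ a diagram automorphism. An element $\iota\in W^+$ with $\iota^2=1$ (possibly $\iota=1$) is called a perfect involution if every $r\in R(W)$ commutes with $\iota r\iota$. The group $W$ acts by conjugation on the set $\mathcal I$ of perfect involutions of $W^+$; write $w\cdot\iota=w\iota w^{-1}$ and $\mathrm{ht}(\iota)=\ell(\iota)/2$. Then $(\mathcal I,\mathrm{ht})$ is a quasiparabolic $W$-set, where heights are allowed to be rational provided that on each $W$-orbit they lie in a fixed coset of $\mathbb Z$. That is, for all $\iota\in\mathcal I$, $w\in W$, $s\in S$ and $r\in R(W)$: (0) $\mathrm{ht}(w\cdot\iota)-\mathrm{ht}(\iota)\in\mathbb Z$ and $|\mathrm{ht}(s\cdot\iota)-\mathrm{ht}(\iota)|\le 1$; (QP1) if $\mathrm{ht}(r\cdot\iota)=\mathrm{ht}(\iota)$,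 then $r\cdot\iota=\iota$; (QP2) if $\mathrm{ht}(r\cdot\iota)>\mathrm{ht}(\iota)$ and $\mathrm{ht}(sr\cdot\iota)<\mathrm{ht}(s\cdot\iota)$, then $r\cdot\iota=s\cdot\iota$. -/

import Mathlib

namespace Quasiparabolic

variable {B W : Type*} [Group W] {M : CoxeterMatrix B}

/-- Diagram automorphisms: the permutations of the set of simple generators which preserve the
Coxeter matrix, i.e. which induce a Coxeter automorphism of `W`. -/
def diagramAut (M : CoxeterMatrix B) : Subgroup (Equiv.Perm B) where
  carrier := {σ | ∀ i j, M (σ i) (σ j) = M i j}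
  mul_mem' := by
    intro σ τ hσ hτ i j
    simp only [Equiv.Perm.mul_apply]
    rw [hσ, hτ]
  one_mem' := fun _ _ => rfl
  inv_mem' := by
    intro σ hσ i j
    have h := hσ (σ⁻¹ i) (σ⁻¹ j)
    simpa using h.symm

theorem isLiftable_diagramAut (cs : CoxeterSystem M W) (σ : diagramAut M) :
    M.IsLiftable (fun i => cs.simple ((σ : Equiv.Perm B) i)) := by
  intro i j
  have h := cs.simple_mul_simple_pow ((σ : Equiv.Perm B) i) ((σ : Equiv.Perm B) j)
  rwa [σ.2 i j] at h

/-- The endomorphism of `W` induced by a diagram automorphism: `s i ↦ s (σ i)`. -/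
def diagramEnd (cs : CoxeterSystem M W) (σ : diagramAut M) : W →* W :=
  cs.lift ⟨fun i => cs.simple ((σ : Equiv.Perm B) i), isLiftable_diagramAut cs σ⟩

theorem diagramEnd_simple (cs : CoxeterSystem M W) (σ : diagramAut M) (i : B) :
    diagramEnd cs σ (cs.simple i) = cs.simple ((σ : Equiv.Perm B) i) :=
  cs.lift_apply_simple (isLiftable_diagramAut cs σ) i

theorem diagramEnd_one (cs : CoxeterSystem M W) : diagramEnd cs 1 = MonoidHom.id W :=
  cs.ext_simple fun i => by simp [diagramEnd_simple]

theorem diagramEnd_mul (cs : CoxeterSystem M W) (σ τ : diagramAut M) :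
    diagramEnd cs (σ * τ) = (diagramEnd cs σ).comp (diagramEnd cs τ) :=
  cs.ext_simple fun i => by simp [diagramEnd_simple]

/-- The action of the group of diagram automorphisms on `W` by Coxeter automorphisms. -/
def diagramAction (cs : CoxeterSystem M W) : diagramAut M →* MulAut W where
  toFun σ := (diagramEnd cs σ).toMulEquiv (diagramEnd cs σ⁻¹)
    (by rw [← diagramEnd_mul, inv_mul_cancel, diagramEnd_one])
    (by rw [← diagramEnd_mul, mul_inv_cancel, diagramEnd_one])
  map_one' := by
    ext w
    simp [diagramEnd_one]
  map_mul' σ τ := by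
    ext w
    simp [diagramEnd_mul]

/-- The extended group `W⁺`: the semidirect product of `W` by its diagram automorphisms. -/
abbrev Ext (cs : CoxeterSystem M W) : Type _ := W ⋊[diagramAction cs] (diagramAut M)

/-- The length on `W⁺`: diagram automorphisms have length `0`, so an element
`w * σ` with `w` in `W` and `σ` a diagram automorphism has the length of `w`. -/
noncomputable def extLength (cs : CoxeterSystem M W) (x : Ext cs) : ℕ := cs.length x.left

/-- Perfect involutions of `W⁺` (the identity counts as an involution). -/
def IsPerfectInvolution (cs : CoxeterSystem M W) (ι : Ext cs) : Prop :=
  ι * ι = 1 ∧ ∀ r : W, cs.IsReflection r →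
    Commute (SemidirectProduct.inl r : Ext cs) (ι * SemidirectProduct.inl r * ι)

theorem IsPerfectInvolution.conj {cs : CoxeterSystem M W} {ι : Ext cs}
    (h : IsPerfectInvolution cs ι) (w : W) :
    IsPerfectInvolution cs
      (SemidirectProduct.inl w * ι * (SemidirectProduct.inl w)⁻¹) := by
  obtain ⟨h1, h2⟩ := h
  set u : Ext cs := SemidirectProduct.inl w with hu
  refine ⟨?_, fun r hr => ?_⟩
  · calc u * ι * u⁻¹ * (u * ι * u⁻¹) = u * (ι * ι) * u⁻¹ := by group
      _ = 1 := by rw [h1]; group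
  · have hr' : cs.IsReflection (w⁻¹ * r * w) := by simpa using hr.conj w⁻¹
    have h3 := congrArg (fun x => u * x * u⁻¹) (h2 _ hr').eq
    simp only [map_mul, map_inv, ← hu] at h3
    set v : Ext cs := SemidirectProduct.inl r
    change v * (u * ι * u⁻¹ * v * (u * ι * u⁻¹)) = u * ι * u⁻¹ * v * (u * ι * u⁻¹) * v
    simp only [mul_assoc, mul_inv_cancel_left, mul_inv_cancel, mul_one] at h3 ⊢
    exact h3

/-- The set of all perfect involutions of `W⁺`. -/
abbrev PerfectInvolution (cs : CoxeterSystem M W) : Type _ :=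
  {ι : Ext cs // IsPerfectInvolution cs ι}

/-- `W` acts on the perfect involutions by conjugation in `W⁺`. -/
instance conjAction (cs : CoxeterSystem M W) : MulAction W (PerfectInvolution cs) where
  smul w ι := ⟨SemidirectProduct.inl w * ι.1 * (SemidirectProduct.inl w)⁻¹, ι.2.conj w⟩
  one_smul ι := Subtype.ext (by
    change SemidirectProduct.inl 1 * ι.1 * (SemidirectProduct.inl 1)⁻¹ = ι.1
    simp)
  mul_smul w w' ι := Subtype.ext (by
    change SemidirectProduct.inl (w * w') * ι.1 * (SemidirectProduct.inl (w * w'))⁻¹ =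
      SemidirectProduct.inl w *
        (SemidirectProduct.inl w' * ι.1 * (SemidirectProduct.inl w')⁻¹) *
        (SemidirectProduct.inl w)⁻¹
    simp only [map_mul, mul_inv_rev, mul_assoc])

/-- The height of a perfect involution is half its length. -/
noncomputable def perfectHeight (cs : CoxeterSystem M W) (ι : PerfectInvolution cs) : ℚ :=
  (extLength cs ι.1 : ℚ) / 2

/-- Scaled `W`-sets. Heights are rational numbers which on each `W`-orbit lie in a fixed
coset of `ℤ`. -/
structure IsScaled (cs : CoxeterSystem M W) {X : Type*} [MulAction W X] (ht : X → ℚ) :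
    Prop where
  integral : ∀ (w : W) (x : X), ∃ k : ℤ, ht (w • x) - ht x = k
  abs_sub_le : ∀ (i : B) (x : X), |ht (cs.simple i • x) - ht x| ≤ 1

/-- Quasiparabolic `W`-sets. -/
structure IsQuasiparabolic (cs : CoxeterSystem M W) {X : Type*} [MulAction W X]
    (ht : X → ℚ) : Prop extends IsScaled cs ht where
  qp1 : ∀ (r : W) (x : X), cs.IsReflection r → ht (r • x) = ht x → r • x = x
  qp2 : ∀ (r : W) (x : X) (i : B), cs.IsReflection r → ht x < ht (r • x) →
    ht (cs.simple i • r • x) < ht (cs.simple i • x) → r • x = cs.simple i • x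

end Quasiparabolic

/-! Write ι = wσ and θ(t) = ιtι⁻¹, and let N(x, t) in ℤ/2 be `inversionCocycle`, which for a
reflection t detects whether tx is shorter than x. Then r·ι has W-part rθ(r)w. If θ(r) = r, then r
fixes ι. Otherwise r and θ(r) are distinct commuting reflections, so N(r, θ(r)) = 0, while ι² = 1
gives N(w, θ(r)) = N(w, r). Hence multiplying by θ(r) and then by r changes the length twice in the
same direction: the height rises or falls strictly according to N(w, r), which is QP1.

For QP2 the hypotheses say N(w, r) = 0 and N(swσ(s), srs) = 1. The cocycle rule leaves only r = s or
r = θ(s), and θ(s)·ι = s·ι by perfectness. -/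

namespace Quasiparabolic

variable {B W : Type*} [Group W] {M : CoxeterMatrix B}

/-! ### The inversion cocycle. -/

open scoped Classical in
/-- The signed permutation of `W × ZMod 2` attached to a simple generator: conjugate the first
coordinate, and flip the sign exactly on the generator itself. -/
noncomputable def signedSimple (cs : CoxeterSystem M W) (i : B) :
    Equiv.Perm (W × ZMod 2) :=
  Function.Involutive.toPerm
    (fun p => (cs.simple i * p.1 * cs.simple i, p.2 + if p.1 = cs.simple i then 1 else 0)) (by
      rintro ⟨t, e⟩
      have h : cs.simple i * t * cs.simple i = cs.simple i ↔ t = cs.simple i := by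
        rw [mul_assoc, mul_eq_left, mul_eq_one_iff_eq_inv, cs.inv_simple]
      refine Prod.ext ?_ ?_
      · simp [mul_assoc]
      · simp only [h, add_assoc, CharTwo.add_self_eq_zero, add_zero])

open scoped Classical in
theorem signedSimple_apply (cs : CoxeterSystem M W) (i : B) (t : W) (e : ZMod 2) :
    signedSimple cs i (t, e) =
      (cs.simple i * t * cs.simple i, e + if t = cs.simple i then 1 else 0) := rfl

open scoped Classical in
theorem signedSimple_mul_pow_apply (cs : CoxeterSystem M W) (i j : B) (n : ℕ) (t : W)
    (e : ZMod 2) :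
    ((signedSimple cs i * signedSimple cs j) ^ n) (t, e) =
      ((cs.simple i * cs.simple j) ^ n * t * (cs.simple j * cs.simple i) ^ n,
        e + ∑ k ∈ Finset.range (2 * n),
          if t = (cs.simple j * cs.simple i) ^ k * cs.simple j then 1 else 0) := by
  induction n generalizing t e with
  | zero => simp
  | succ n ih =>
    rw [pow_succ, Equiv.Perm.mul_apply, Equiv.Perm.mul_apply, signedSimple_apply,
      signedSimple_apply, ih]
    set a := cs.simple i with ha
    set b := cs.simple j with hb
    have hbb : b⁻¹ = b := cs.inv_simple j
    have h1 : b * t * b = a ↔ t = (b * a) ^ 1 * b := by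
      rw [pow_one, ← mul_inv_eq_iff_eq_mul, hbb, mul_assoc, ← eq_inv_mul_iff_mul_eq, hbb]
    have h2 (k : ℕ) : a * (b * t * b) * a = (b * a) ^ k * b ↔ t = (b * a) ^ (k + 2) * b := by
      have : (b * a) ^ (k + 2) * b = (b * a) * ((b * a) ^ k * b) * (a * b) := by
        have hc : (b * a) ^ k * (b * a) = (b * a) * (b * a) ^ k := (pow_succ _ _).symm.trans
          (pow_succ' _ _)
        calc (b * a) ^ (k + 2) * b = (b * a) ^ k * (b * a) * (b * a) * b := by
              rw [pow_add, pow_two, ← mul_assoc]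
          _ = _ := by rw [hc]; simp only [mul_assoc]
      rw [this]
      constructor
      · intro h
        rw [← h]
        simp [ha, hb, mul_assoc]
      · intro h
        rw [h]
        simp [ha, hb, mul_assoc]
    refine Prod.ext ?_ ?_
    · change _ * (a * (b * t * b) * a) * _ = _
      rw [pow_succ (a * b), pow_succ' (b * a)]
      simp only [mul_assoc]
    · simp only [h1, h2]
      -- The terms k = 0, 1 are the flips made by the pair applied first; the other terms are
      -- shifted by two.
      rw [show 2 * (n + 1) = 2 * n + 1 + 1 by ring, Finset.sum_range_succ', Finset.sum_range_succ']
      simp only [pow_zero, one_mul, zero_add, add_assoc, Nat.reduceAdd]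
      ring

/-- For n = M i j the summands are periodic in k with period n, so the 2n flips cancel in pairs. -/
theorem isLiftable_signedSimple (cs : CoxeterSystem M W) : M.IsLiftable (signedSimple cs) := by
  classical
  intro i j
  ext1 ⟨t, e⟩
  rw [signedSimple_mul_pow_apply, two_mul, Finset.sum_range_add]
  simp only [pow_add, cs.simple_mul_simple_pow, cs.simple_mul_simple_pow', one_mul, mul_one,
    CharTwo.add_self_eq_zero, add_zero, Equiv.Perm.one_apply]

/-- The action of `W` on signed elements. On reflections this is the action on roots. -/
noncomputable def signedAction (cs : CoxeterSystem M W) : W →* Equiv.Perm (W × ZMod 2) :=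
  cs.lift ⟨signedSimple cs, isLiftable_signedSimple cs⟩

theorem signedAction_simple (cs : CoxeterSystem M W) (i : B) :
    signedAction cs (cs.simple i) = signedSimple cs i :=
  cs.lift_apply_simple (isLiftable_signedSimple cs) i

/-- The sign picked up by `t` under the action of `w⁻¹`. For a reflection `t` it is `1` exactly
when `t` is a left inversion of `w`. -/
noncomputable def inversionCocycle (cs : CoxeterSystem M W) (w t : W) : ZMod 2 :=
  (signedAction cs w⁻¹ (t, 0)).2

theorem signedAction_apply (cs : CoxeterSystem M W) (w t : W) (e : ZMod 2) :
    signedAction cs w (t, e) = (w * t * w⁻¹, e + inversionCocycle cs w⁻¹ t) := by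
  rw [inversionCocycle, inv_inv]
  induction w using cs.simple_induction_left generalizing t e with
  | one => simp
  | mul_simple_left w i ih =>
    rw [map_mul, Equiv.Perm.mul_apply, Equiv.Perm.mul_apply, ih, ih t 0, signedAction_simple,
      signedSimple_apply, signedSimple_apply]
    simp [mul_assoc, add_assoc]

theorem inversionCocycle_mul (cs : CoxeterSystem M W) (x y t : W) :
    inversionCocycle cs (x * y) t =
      inversionCocycle cs x t + inversionCocycle cs y (x⁻¹ * t * x) := by
  conv_lhs => rw [inversionCocycle, mul_inv_rev, map_mul, Equiv.Perm.mul_apply,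
    signedAction_apply, signedAction_apply]
  simp

open scoped Classical in
theorem inversionCocycle_simple (cs : CoxeterSystem M W) (i : B) (t : W) :
    inversionCocycle cs (cs.simple i) t = if t = cs.simple i then 1 else 0 := by
  rw [inversionCocycle, cs.inv_simple, signedAction_simple, signedSimple_apply]
  simp

theorem inversionCocycle_one (cs : CoxeterSystem M W) (t : W) :
    inversionCocycle cs 1 t = 0 := by
  simp [inversionCocycle]

-- Along r = usu⁻¹ the contributions of u and u⁻¹ cancel because r fixes t under conjugation; only
-- the middle s can flip the sign.
open scoped Classical in
theorem inversionCocycle_of_commute (cs : CoxeterSystem M W) {r t : W} (hr : cs.IsReflection r)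
    (h : Commute r t) : inversionCocycle cs r t = if t = r then 1 else 0 := by
  obtain ⟨u, i, rfl⟩ := hr
  set s := cs.simple i with hs
  have hconj : (u * s)⁻¹ * t * (u * s) = u⁻¹ * t * u := by
    have h' := congrArg (fun x => s⁻¹ * u⁻¹ * x * u) h.eq
    simp only [mul_assoc, inv_mul_cancel_left, inv_mul_cancel, mul_one] at h'
    simpa only [mul_inv_rev, mul_assoc] using h'.symm
  have hone := inversionCocycle_mul cs u u⁻¹ t
  rw [mul_inv_cancel, inversionCocycle_one] at hone
  have heq : u⁻¹ * t * u = s ↔ t = u * s * u⁻¹ := by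
    constructor
    · rintro h1
      rw [← h1]
      group
    · rintro rfl
      group
  rw [inversionCocycle_mul, hconj, inversionCocycle_mul, inversionCocycle_simple, heq,
    add_right_comm, ← hone, zero_add]

theorem mem_leftInvSeq_of_inversionCocycle_ne_zero (cs : CoxeterSystem M W) (ω : List B) (t : W)
    (h : inversionCocycle cs (cs.wordProd ω) t ≠ 0) : t ∈ cs.leftInvSeq ω := by
  induction ω generalizing t with
  | nil => simp [inversionCocycle_one] at h
  | cons i ω ih =>
    rw [cs.wordProd_cons, inversionCocycle_mul, inversionCocycle_simple] at h
    rw [CoxeterSystem.leftInvSeq, List.mem_cons, List.mem_map]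
    by_cases hti : t = cs.simple i
    · exact Or.inl hti
    · rw [if_neg hti, zero_add] at h
      exact Or.inr ⟨_, ih _ h, by simp [mul_assoc]⟩

/-- A reduced word gives one direction. Applied to tw, where the cocycle at t differs by one, it
gives the converse. -/
theorem inversionCocycle_eq_one_iff (cs : CoxeterSystem M W) {t : W} (ht : cs.IsReflection t)
    (w : W) : inversionCocycle cs w t = 1 ↔ cs.length (t * w) < cs.length w := by
  have key (w : W) (h : inversionCocycle cs w t = 1) : cs.length (t * w) < cs.length w := by
    obtain ⟨ω, hω, rfl⟩ := cs.exists_isReduced w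
    exact (cs.isLeftInversion_of_mem_leftInvSeq hω
      (mem_leftInvSeq_of_inversionCocycle_ne_zero cs ω t (by simp [h]))).2
  refine ⟨key w, fun h => ?_⟩
  by_contra hne
  have h0 : inversionCocycle cs w t = 0 := by
    generalize inversionCocycle cs w t = e at hne
    revert e
    decide
  have h1 := key (t * w) (by
    rw [inversionCocycle_mul, inversionCocycle_of_commute cs ht (Commute.refl t), if_pos rfl,
      inv_mul_cancel, one_mul, h0, add_zero])
  rw [← mul_assoc, ht.mul_self, one_mul] at h1
  exact lt_asymm h h1

theorem inversionCocycle_eq_zero_iff (cs : CoxeterSystem M W) {t : W} (ht : cs.IsReflection t)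
    (w : W) : inversionCocycle cs w t = 0 ↔ cs.length w < cs.length (t * w) := by
  have h01 (e : ZMod 2) : e = 0 ↔ e ≠ 1 := by revert e; decide
  rw [h01, Ne, inversionCocycle_eq_one_iff cs ht, not_lt]
  exact ⟨fun h => lt_of_le_of_ne h (ht.length_mul_right_ne w).symm, le_of_lt⟩

/-! ### Diagram automorphisms and conjugation by ι. -/

theorem diagramAction_simple (cs : CoxeterSystem M W) (σ : diagramAut M) (i : B) :
    diagramAction cs σ (cs.simple i) = cs.simple ((σ : Equiv.Perm B) i) :=
  diagramEnd_simple cs σ i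

theorem length_diagramAction_le (cs : CoxeterSystem M W) (σ : diagramAut M) (w : W) :
    cs.length (diagramAction cs σ w) ≤ cs.length w := by
  obtain ⟨ω, hω, rfl⟩ := cs.exists_isReduced w
  have h : diagramAction cs σ (cs.wordProd ω) = cs.wordProd (ω.map (σ : Equiv.Perm B)) := by
    simp [CoxeterSystem.wordProd, map_list_prod, Function.comp_def, diagramAction_simple]
  rw [h, hω.eq]
  simpa using cs.length_wordProd_le (ω.map (σ : Equiv.Perm B))

theorem length_diagramAction (cs : CoxeterSystem M W) (σ : diagramAut M) (w : W) :
    cs.length (diagramAction cs σ w) = cs.length w := by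
  refine le_antisymm (length_diagramAction_le cs σ w) ?_
  simpa using length_diagramAction_le cs σ⁻¹ (diagramAction cs σ w)

theorem isReflection_diagramAction (cs : CoxeterSystem M W) (σ : diagramAut M) {t : W}
    (ht : cs.IsReflection t) : cs.IsReflection (diagramAction cs σ t) := by
  obtain ⟨u, i, rfl⟩ := ht
  exact ⟨diagramAction cs σ u, (σ : Equiv.Perm B) i, by simp [diagramAction_simple]⟩

/-- Conjugation by an element of `W⁺`, as a map on `W`. -/
def extConj (cs : CoxeterSystem M W) (ι : Ext cs) (t : W) : W :=
  ι.left * diagramAction cs ι.right t * ι.left⁻¹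

theorem isReflection_extConj (cs : CoxeterSystem M W) (ι : Ext cs) {t : W}
    (ht : cs.IsReflection t) : cs.IsReflection (extConj cs ι t) :=
  (isReflection_diagramAction cs ι.right ht).conj ι.left

theorem inl_extConj (cs : CoxeterSystem M W) (ι : Ext cs) (t : W) :
    (SemidirectProduct.inl (extConj cs ι t) : Ext cs) = ι * SemidirectProduct.inl t * ι⁻¹ := by
  ext <;> simp [extConj]

theorem inv_left_of_mul_self (cs : CoxeterSystem M W) {ι : Ext cs} (h : ι * ι = 1) :
    ι.left⁻¹ = diagramAction cs ι.right ι.left := by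
  have h1 := congrArg SemidirectProduct.left h
  rw [SemidirectProduct.mul_left, SemidirectProduct.one_left] at h1
  exact inv_eq_of_mul_eq_one_right h1

theorem smul_left (cs : CoxeterSystem M W) (w : W) (ι : PerfectInvolution cs) :
    (w • ι).1.left = w * ι.1.left * diagramAction cs ι.1.right w⁻¹ := by
  change (SemidirectProduct.inl w * ι.1 * (SemidirectProduct.inl w)⁻¹ : Ext cs).left = _
  simp [← map_inv]

theorem smul_left_of_isReflection (cs : CoxeterSystem M W) {r : W} (hr : cs.IsReflection r)
    (ι : PerfectInvolution cs) :
    (r • ι).1.left = r * extConj cs ι.1 r * ι.1.left := by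
  rw [smul_left, hr.inv, extConj]
  group

theorem commute_extConj (cs : CoxeterSystem M W) {r : W} (hr : cs.IsReflection r)
    (ι : PerfectInvolution cs) : Commute r (extConj cs ι.1 r) := by
  have h := ι.2.2 r hr
  have h1 := inl_extConj cs ι.1 r
  rw [inv_eq_of_mul_eq_one_right ι.2.1] at h1
  rw [← h1] at h
  exact SemidirectProduct.inl_injective (by simpa only [map_mul] using h.eq)

/-- Since σ(w) = w⁻¹, applying σ and then inverting turns rw into θ(r)w, and both operations
preserve length. -/
theorem inversionCocycle_extConj (cs : CoxeterSystem M W) {r : W} (hr : cs.IsReflection r)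
    {ι : Ext cs} (h : ι * ι = 1) :
    inversionCocycle cs ι.left (extConj cs ι r) = inversionCocycle cs ι.left r := by
  have hlen : cs.length (extConj cs ι r * ι.left) = cs.length (r * ι.left) := by
    rw [← length_diagramAction cs ι.right (r * ι.left), map_mul, ← inv_left_of_mul_self cs h,
      ← cs.length_inv, extConj, inv_mul_cancel_right, mul_inv_rev,
      (isReflection_diagramAction cs ι.right hr).inv]
  have h1 := inversionCocycle_eq_one_iff cs (isReflection_extConj cs ι hr) ι.left
  rw [hlen, ← inversionCocycle_eq_one_iff cs hr] at h1
  generalize inversionCocycle cs ι.left (extConj cs ι r) = a at h1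
  generalize inversionCocycle cs ι.left r = b at h1
  revert a b
  decide

theorem smul_eq_self_of_extConj_eq (cs : CoxeterSystem M W) {r : W} (ι : PerfectInvolution cs)
    (h : extConj cs ι.1 r = r) : r • ι = ι := by
  have h1 := inl_extConj cs ι.1 r
  rw [h] at h1
  refine Subtype.ext ?_
  change (SemidirectProduct.inl r * ι.1 * (SemidirectProduct.inl r)⁻¹ : Ext cs) = ι.1
  nth_rw 1 [h1]
  group

/-! ### Height change under reflections, and QP1. -/

theorem inversionCocycle_mul_extConj (cs : CoxeterSystem M W) {r : W} (hr : cs.IsReflection r)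
    (ι : PerfectInvolution cs) (hne : extConj cs ι.1 r ≠ r) :
    inversionCocycle cs (r * ι.1.left) (extConj cs ι.1 r) =
      inversionCocycle cs ι.1.left r := by
  have hc := commute_extConj cs hr ι
  rw [inversionCocycle_mul, inversionCocycle_of_commute cs hr hc, if_neg hne, zero_add,
    mul_assoc, ← hc.eq, inv_mul_cancel_left, inversionCocycle_extConj cs hr ι.2.1]

theorem length_lt_length_smul (cs : CoxeterSystem M W) {r : W} (hr : cs.IsReflection r)
    (ι : PerfectInvolution cs) (hne : extConj cs ι.1 r ≠ r)
    (h : inversionCocycle cs ι.1.left r = 0) :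
    cs.length ι.1.left < cs.length (r • ι).1.left := by
  have h2 := inversionCocycle_mul_extConj cs hr ι hne
  rw [h, inversionCocycle_eq_zero_iff cs (isReflection_extConj cs ι.1 hr), ← mul_assoc,
    ← (commute_extConj cs hr ι).eq, ← smul_left_of_isReflection cs hr] at h2
  exact ((inversionCocycle_eq_zero_iff cs hr _).1 h).trans h2

theorem length_smul_lt_length (cs : CoxeterSystem M W) {r : W} (hr : cs.IsReflection r)
    (ι : PerfectInvolution cs) (hne : extConj cs ι.1 r ≠ r)
    (h : inversionCocycle cs ι.1.left r = 1) :
    cs.length (r • ι).1.left < cs.length ι.1.left := by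
  have h2 := inversionCocycle_mul_extConj cs hr ι hne
  rw [h, inversionCocycle_eq_one_iff cs (isReflection_extConj cs ι.1 hr), ← mul_assoc,
    ← (commute_extConj cs hr ι).eq, ← smul_left_of_isReflection cs hr] at h2
  exact h2.trans ((inversionCocycle_eq_one_iff cs hr _).1 h)

theorem inversionCocycle_eq_zero_or_one (cs : CoxeterSystem M W) (w t : W) :
    inversionCocycle cs w t = 0 ∨ inversionCocycle cs w t = 1 := by
  generalize inversionCocycle cs w t = e
  revert e
  decide

theorem perfectHeight_lt_iff (cs : CoxeterSystem M W) (ι κ : PerfectInvolution cs) :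
    perfectHeight cs ι < perfectHeight cs κ ↔ cs.length ι.1.left < cs.length κ.1.left := by
  rw [perfectHeight, perfectHeight, div_lt_div_iff_of_pos_right two_pos, Nat.cast_lt]
  rfl

theorem smul_eq_self_of_perfectHeight_eq (cs : CoxeterSystem M W) {r : W}
    (hr : cs.IsReflection r) (ι : PerfectInvolution cs)
    (h : perfectHeight cs (r • ι) = perfectHeight cs ι) : r • ι = ι := by
  by_cases hne : extConj cs ι.1 r = r
  · exact smul_eq_self_of_extConj_eq cs ι hne
  · rcases inversionCocycle_eq_zero_or_one cs ι.1.left r with h0 | h1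
    · exact absurd h ((perfectHeight_lt_iff cs _ _).2 (length_lt_length_smul cs hr ι hne h0)).ne'
    · exact absurd h ((perfectHeight_lt_iff cs _ _).2 (length_smul_lt_length cs hr ι hne h1)).ne

theorem inversionCocycle_of_perfectHeight_lt (cs : CoxeterSystem M W) {r : W}
    (hr : cs.IsReflection r) (ι : PerfectInvolution cs)
    (h : perfectHeight cs ι < perfectHeight cs (r • ι)) :
    inversionCocycle cs ι.1.left r = 0 := by
  refine (inversionCocycle_eq_zero_or_one cs _ _).resolve_right fun h1 => ?_
  by_cases hne : extConj cs ι.1 r = r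
  · exact h.ne (by rw [smul_eq_self_of_extConj_eq cs ι hne])
  · exact lt_asymm h ((perfectHeight_lt_iff cs _ _).2 (length_smul_lt_length cs hr ι hne h1))

theorem inversionCocycle_of_perfectHeight_gt (cs : CoxeterSystem M W) {r : W}
    (hr : cs.IsReflection r) (ι : PerfectInvolution cs)
    (h : perfectHeight cs (r • ι) < perfectHeight cs ι) :
    inversionCocycle cs ι.1.left r = 1 := by
  refine (inversionCocycle_eq_zero_or_one cs _ _).resolve_left fun h0 => ?_
  by_cases hne : extConj cs ι.1 r = r
  · exact h.ne (by rw [smul_eq_self_of_extConj_eq cs ι hne])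
  · exact lt_asymm h ((perfectHeight_lt_iff cs _ _).2 (length_lt_length_smul cs hr ι hne h0))

/-! ### QP2. -/

theorem extConj_smul (cs : CoxeterSystem M W) {t : W} (ht : cs.IsReflection t)
    (ι : PerfectInvolution cs) : extConj cs ι.1 t • ι = t • ι := by
  refine Subtype.ext ?_
  change (SemidirectProduct.inl (extConj cs ι.1 t) * ι.1 *
    (SemidirectProduct.inl (extConj cs ι.1 t))⁻¹ : Ext cs) =
      SemidirectProduct.inl t * ι.1 * (SemidirectProduct.inl t)⁻¹
  have hι : ι.1⁻¹ = ι.1 := inv_eq_of_mul_eq_one_right ι.2.1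
  have hc := ι.2.2 t ht
  have htt : (SemidirectProduct.inl t : Ext cs)⁻¹ = SemidirectProduct.inl t := by
    rw [← map_inv, ht.inv]
  rw [inl_extConj, hι, htt]
  generalize (SemidirectProduct.inl t : Ext cs) = u at hc htt
  rw [mul_inv_rev, mul_inv_rev, htt, hι]
  calc ι.1 * u * ι.1 * ι.1 * (ι.1 * (u * ι.1))
      = ι.1 * u * (ι.1 * ι.1) * ι.1 * u * ι.1 := by simp only [mul_assoc]
    _ = (ι.1 * u * ι.1) * u * ι.1 := by rw [ι.2.1, mul_one]
    _ = u * ι.1 * u * (ι.1 * ι.1) := by rw [← hc.eq]; simp only [mul_assoc]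
    _ = u * ι.1 * u := by rw [ι.2.1, mul_one]

theorem smul_eq_simple_smul (cs : CoxeterSystem M W) {r : W} (hr : cs.IsReflection r)
    (ι : PerfectInvolution cs) (i : B) (h : perfectHeight cs ι < perfectHeight cs (r • ι))
    (h' : perfectHeight cs (cs.simple i • r • ι) < perfectHeight cs (cs.simple i • ι)) :
    r • ι = cs.simple i • ι := by
  set s := cs.simple i with hs
  have h0 := inversionCocycle_of_perfectHeight_lt cs hr ι h
  have hr' : cs.IsReflection (s * r * s⁻¹) := hr.conj s
  -- Seen as the reflection srs⁻¹ acting on s·ι, the height drop becomes a cocycle value.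
  have hsmul : s • r • ι = (s * r * s⁻¹) • s • ι := by simp only [smul_smul]; group
  rw [hsmul] at h'
  have h1 := inversionCocycle_of_perfectHeight_gt cs hr' (s • ι) h'
  have hconj : s⁻¹ * (s * r * s⁻¹) * s = r := by group
  rw [smul_left, mul_assoc, inversionCocycle_mul, hconj, inversionCocycle_mul, h0, zero_add, hs,
    cs.inv_simple, diagramAction_simple, inversionCocycle_simple, inversionCocycle_simple,
    ← diagramAction_simple] at h1
  by_cases hrs : r = s
  · rw [hrs]
  · rw [if_neg (by simpa [mul_assoc, mul_eq_one_iff_eq_inv] using hrs), zero_add] at h1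
    -- Only the last factor σ(s) can now account for the inversion.
    have hrθ : r = extConj cs ι.1 s := by
      have h2 : ι.1.left⁻¹ * r * ι.1.left = diagramAction cs ι.1.right s := by
        by_contra hcon
        rw [if_neg hcon] at h1
        exact zero_ne_one h1
      rw [extConj, ← h2]
      group
    rw [hrθ]
    exact extConj_smul cs (cs.isReflection_simple i) ι

/-! ### Integrality and bounded steps. -/

theorem exists_int_perfectHeight_sub (cs : CoxeterSystem M W) (w : W)
    (ι : PerfectInvolution cs) :
    ∃ k : ℤ, perfectHeight cs (w • ι) - perfectHeight cs ι = k := by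
  -- Twisted conjugation adds ℓ(w) + ℓ(w⁻¹), an even number, to the length modulo 2.
  have hmod : cs.length (w • ι).1.left % 2 = cs.length ι.1.left % 2 := by
    rw [smul_left, cs.length_mul_mod_two, Nat.add_mod, cs.length_mul_mod_two,
      length_diagramAction, cs.length_inv]
    omega
  refine ⟨((cs.length (w • ι).1.left : ℤ) - cs.length ι.1.left) / 2, ?_⟩
  rw [Int.cast_div (by omega) (by norm_num), perfectHeight, perfectHeight, extLength, extLength]
  push_cast
  ring

theorem abs_perfectHeight_simple_smul_sub_le (cs : CoxeterSystem M W) (i : B)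
    (ι : PerfectInvolution cs) :
    |perfectHeight cs (cs.simple i • ι) - perfectHeight cs ι| ≤ 1 := by
  have hl := smul_left cs (cs.simple i) ι
  rw [cs.inv_simple, diagramAction_simple] at hl
  have h1 := cs.length_simple_mul ι.1.left i
  have h2 := cs.length_mul_simple (cs.simple i * ι.1.left) ((ι.1.right : Equiv.Perm B) i)
  rw [← hl] at h2
  have h3 : cs.length (cs.simple i • ι).1.left ≤ cs.length ι.1.left + 2 := by omega
  have h4 : cs.length ι.1.left ≤ cs.length (cs.simple i • ι).1.left + 2 := by omega
  rw [perfectHeight, perfectHeight, extLength, extLength, abs_le]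
  qify at h3 h4
  constructor <;> linarith

end Quasiparabolic

theorem mainTheorem4 {B W : Type*} [Finite B] [Group W] {M : CoxeterMatrix B}
    (cs : CoxeterSystem M W) :
    Quasiparabolic.IsQuasiparabolic cs
      (X := Quasiparabolic.PerfectInvolution cs) (Quasiparabolic.perfectHeight cs) where
  integral := Quasiparabolic.exists_int_perfectHeight_sub cs
  abs_sub_le := Quasiparabolic.abs_perfectHeight_simple_smul_sub_le cs
  qp1 _ ι hr := Quasiparabolic.smul_eq_self_of_perfectHeight_eq cs hr ι
  qp2 _ ι i hr := Quasiparabolic.smul_eq_simple_smul cs hr ι i
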